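/- A *set of circles* is a finite multiset $C$ of positive real numbers, the areas of the circles; its combined area is the sum of its elements. A set of circles $C$ *can be packed* into a region $S$ of the Euclidean plane if one can place, for each element $c$ of $C$ (with multiplicity), a closed disk of area $c$ inside $S$ such that no two of the placed disks have a common interior point (touching is allowed). The *twincircles* of $S$ are the largest two equal circles that can be packed into $S$, and the *twincircle area* of $S$ is their combined area. The *critical density* for packing circles into $S$ is the ratio $A/\operatorname{area}(S)$, where $A$ is the largest number such that every set of circles with combined area at most $A$ can be packed into $S$. **Theorem.** Let $S$ be a closed solid square in the plane (of any positive side length, in any position). Then $S$ has twincircles. If $a$ denotes its twincircle area, then every set of circles with combined area at most $a$ can be packed into $S$. This bound is tight: for every $b>a$ there is a set of circles with combined area exactly $b$ that cannot be packed into $S$. Moreover, the critical density for packing circles into $S$ exists and equals $$\phi_s=\frac{\pi}{3+2\sqrt2}\approx 0.5390,$$ where the approximation means $|\phi_s-0.5390|<0.00005$. -/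

import Mathlib

open MeasureTheory

namespace CirclePacking

/-- The Euclidean plane. -/
abbrev Plane : Type := EuclideanSpace ℝ (Fin 2)

/-- The area of a region of the plane, i.e. its two-dimensional Lebesgue measure. -/
noncomputable def area (S : Set Plane) : ℝ := (volume : Measure Plane).real S

/-- A circle placed in the plane, with positive radius. -/
structure Circle where
  center : Plane
  radius : ℝ
  radius_pos : 0 < radius

/-- The closed disk bounded by a circle. -/
def Circle.disk (D : Circle) : Set Plane := Metric.closedBall D.center D.radius

/-- The area of a circle is the area of its disk. -/
noncomputable def Circle.area (D : Circle) : ℝ := CirclePacking.area D.disk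

/-- Two circles do not overlap if their disks have no common interior point
(touching is allowed). -/
def Circle.NonOverlapping (D E : Circle) : Prop :=
  Disjoint (interior D.disk) (interior E.disk)

/-- A finite collection (with multiplicities) of placed circles is a packing in `S` if all of them
lie in `S` and no two of them overlap. In particular, no circle occurs twice. -/
def IsPacking (P : Multiset Circle) (S : Set Plane) : Prop :=
  (∀ D ∈ P, D.disk ⊆ S) ∧ P.Pairwise Circle.NonOverlapping

/-- The sets of circles: finite multisets of positive real numbers (the circles' areas). -/
def circleSets : Set (Multiset ℝ) := {C | ∀ c ∈ C, 0 < c}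

/-- The sets of circles of combined area at most `a`. -/
def circleSetsUpTo (a : ℝ) : Set (Multiset ℝ) := {C | C ∈ circleSets ∧ C.sum ≤ a}

/-- The set of circles with the areas `C` can be packed into `S`. -/
def CanPack (C : Multiset ℝ) (S : Set Plane) : Prop :=
  ∃ P : Multiset Circle, P.map Circle.area = C ∧ IsPacking P S

/-- Every set of circles belonging to the class `𝒞` can be packed into `S`. -/
def IsShapeFor (𝒞 : Set (Multiset ℝ)) (S : Set Plane) : Prop := ∀ C ∈ 𝒞, CanPack C S

/-- `D₁` and `D₂` are twincircles of `S`: two equal circles packed into `S`, and no two larger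
equal circles can be packed into `S`. -/
def IsTwincircles (S : Set Plane) (D₁ D₂ : Circle) : Prop :=
  D₁.radius = D₂.radius ∧ IsPacking {D₁, D₂} S ∧
    ∀ E₁ E₂ : Circle, E₁.radius = E₂.radius → IsPacking {E₁, E₂} S → E₁.radius ≤ D₁.radius

/-- The twincircle area of `S` is `a`: the twincircles of `S` exist and their combined area
is `a`. -/
def HasTwincircleArea (S : Set Plane) (a : ℝ) : Prop :=
  ∃ D₁ D₂ : Circle, IsTwincircles S D₁ D₂ ∧ D₁.area + D₂.area = a

/-- `d` is the critical density for packing circles into `S`: there is a largest number `A` such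
that all sets of circles of combined area at most `A` can be packed into `S`, and `d` is the ratio
between `A` and the area of `S`. -/
def HasCriticalDensity (S : Set Plane) (d : ℝ) : Prop :=
  ∃ A : ℝ, IsGreatest {A : ℝ | IsShapeFor (circleSetsUpTo A) S} A ∧ d = A / area S

/-- `S` is a (closed, solid) square of side length `s` in the plane, at any position and with any
orientation. -/
def IsSquareOfSide (S : Set Plane) (s : ℝ) : Prop :=
  0 < s ∧ ∃ e : Plane ≃ᵢ Plane, S = e '' {x : Plane | ∀ i, x i ∈ Set.Icc (0 : ℝ) s}

end CirclePacking

namespace CirclePacking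

open Multiset

/-! This is a split packing. An isosceles right triangle with inradius `r` has legs `(2 + √2) * r`,
so a square of side `(2 + √2) * r` is cut by a diagonal into two triangles whose incircles are its
twincircles, of combined area `2πr²`. Split the circles into two groups with sums as equal as
possible. Give each group a triangle whose incircle has exactly the area of the group, placed at
opposite corners of the square. Within a triangle, recurse along its altitude
(`canPlace_inTriangle`). By Cauchy–Schwarz the two resized triangles fit side by side, but the
larger may poke out of its container at an acute corner. Balance saves this: every circle of the
larger group is at least the difference of the sums, too big to reach far into that corner
(`triangle_corner_bound`, `square_corner_bound`). Tightness is witnessed by two equal circles beyond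
the twincircle size. -/

/-- Every finite multiset of positive numbers splits into two parts whose sums differ by at most
each single element of the part with the larger sum. -/
theorem exists_balanced_split {C : Multiset ℝ} (hC : C ∈ circleSets) :
    ∃ C₁ C₂ : Multiset ℝ, C₁ + C₂ = C ∧ (∀ c ∈ C₁, C₁.sum - C₂.sum ≤ c) ∧
      (∀ c ∈ C₂, C₂.sum - C₁.sum ≤ c) := by
  classical
  obtain ⟨⟨C₁, C₂⟩, hmem, hmin⟩ := Finset.exists_min_image C.antidiagonal.toFinset
    (fun x => |x.1.sum - x.2.sum|) ⟨(0, C), by simp⟩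
  have hadd : C₁ + C₂ = C := by simpa using hmem
  have hmin' : ∀ B₁ B₂ : Multiset ℝ, B₁ + B₂ = C →
      |C₁.sum - C₂.sum| ≤ |B₁.sum - B₂.sum| := fun B₁ B₂ h => by
    simpa using hmin (B₁, B₂) (by simpa using h)
  have hpos : ∀ c ∈ C₁ + C₂, 0 < c := hadd ▸ hC
  refine ⟨C₁, C₂, hadd, fun c hc => ?_, fun c hc => ?_⟩
  -- If `c` were smaller than the difference of the sums, moving it to the other part would strictly
  -- reduce their distance, contradicting minimality.
  · by_contra! hlt
    have hc0 := hpos c (mem_add.2 (Or.inl hc))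
    obtain ⟨B, rfl⟩ := exists_cons_of_mem hc
    have h := hmin' B (c ::ₘ C₂) (by rw [← hadd]; simp)
    simp only [sum_cons] at h hlt
    rw [abs_of_pos (by linarith), le_abs] at h
    rcases h with h | h <;> linarith
  · by_contra! hlt
    have hc0 := hpos c (mem_add.2 (Or.inr hc))
    obtain ⟨B, rfl⟩ := exists_cons_of_mem hc
    have h := hmin' (c ::ₘ C₁) B (by rw [← hadd]; simp)
    simp only [sum_cons] at h hlt
    rw [abs_of_neg (by linarith), le_abs] at h
    rcases h with h | h <;> linarith

/-! ### Areas, separation and placement of circles -/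

theorem Circle.area_eq (D : Circle) : D.area = Real.pi * D.radius ^ 2 := by
  have h := InnerProductSpace.volume_closedBall_of_dim_even (E := Plane) (k := 1)
    (by simp) D.center D.radius
  have hr := D.radius_pos.le
  rw [Circle.area, CirclePacking.area, Circle.disk, Measure.real, h]
  simp [ENNReal.toReal_ofReal, hr, Real.pi_pos.le, mul_comm]

theorem Circle.nonOverlapping_iff (D E : Circle) :
    D.NonOverlapping E ↔ D.radius + E.radius ≤ dist D.center E.center := by
  rw [Circle.NonOverlapping, Circle.disk, Circle.disk, interior_closedBall _ D.radius_pos.ne',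
    interior_closedBall _ E.radius_pos.ne', disjoint_ball_ball_iff D.radius_pos E.radius_pos]

/-- Two circles on different sides of a line do not overlap. -/
theorem Circle.nonOverlapping_of_inner {D E : Circle} {u : Plane} (hu : inner ℝ u u = 1)
    (h : D.radius + E.radius ≤ inner ℝ u (D.center - E.center)) : D.NonOverlapping E := by
  rw [Circle.nonOverlapping_iff, dist_eq_norm]
  have hn : ‖u‖ = 1 := by
    rw [real_inner_self_eq_norm_sq] at hu
    exact (pow_eq_one_iff_of_nonneg (norm_nonneg _) two_ne_zero).1 hu
  have := real_inner_le_norm u (D.center - E.center)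
  rw [hn, one_mul] at this
  exact h.trans this

/-- The circles with the areas `C` can be placed without overlap, each with the property `Q`. -/
def CanPlace (C : Multiset ℝ) (Q : Circle → Prop) : Prop :=
  ∃ l : List Circle, (l.map Circle.area : Multiset ℝ) = C ∧ (∀ D ∈ l, Q D) ∧
    l.Pairwise Circle.NonOverlapping

/-- The transfers to `Q` may use `D.area ∈ Cᵢ`: this is how the lower bound on radii in a balanced
split enters the containment argument. -/
theorem CanPlace.add {C₁ C₂ : Multiset ℝ} {Q₁ Q₂ Q : Circle → Prop} (h₁ : CanPlace C₁ Q₁)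
    (h₂ : CanPlace C₂ Q₂) (hQ₁ : ∀ D, D.area ∈ C₁ → Q₁ D → Q D)
    (hQ₂ : ∀ D, D.area ∈ C₂ → Q₂ D → Q D) (h : ∀ D E, Q₁ D → Q₂ E → D.NonOverlapping E) :
    CanPlace (C₁ + C₂) Q := by
  obtain ⟨l₁, rfl, hl₁, hp₁⟩ := h₁
  obtain ⟨l₂, rfl, hl₂, hp₂⟩ := h₂
  refine ⟨l₁ ++ l₂, by simp, fun D hD => ?_, List.pairwise_append.2 ⟨hp₁, hp₂, fun D hD E hE =>
    h D E (hl₁ D hD) (hl₂ E hE)⟩⟩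
  rcases List.mem_append.1 hD with hD | hD
  · exact hQ₁ D (by simpa using ⟨D, hD, rfl⟩) (hl₁ D hD)
  · exact hQ₂ D (by simpa using ⟨D, hD, rfl⟩) (hl₂ D hD)

theorem CanPlace.canPack {C : Multiset ℝ} {Q : Circle → Prop} {S : Set Plane} (h : CanPlace C Q)
    (hQ : ∀ D, Q D → D.disk ⊆ S) : CanPack C S := by
  obtain ⟨l, rfl, hl, hp⟩ := h
  exact ⟨l, by simp, fun D hD => hQ D (hl D (by simpa using hD)), l, rfl, hp⟩

/-- The disk of the circle `D` lies in the isosceles right triangle that has its right angle at `p`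
and legs of length `L` in the orthogonal directions `u` and `v`. -/
def InTriangle (p u v : Plane) (L : ℝ) (D : Circle) : Prop :=
  D.radius ≤ inner ℝ u (D.center - p) ∧ D.radius ≤ inner ℝ v (D.center - p) ∧
    inner ℝ u (D.center - p) + inner ℝ v (D.center - p) + √2 * D.radius ≤ L

theorem InTriangle.symm {p u v : Plane} {L : ℝ} {D : Circle} (h : InTriangle p u v L D) :
    InTriangle p v u L D :=
  ⟨h.2.1, h.1, by rw [add_comm (inner ℝ v _)]; exact h.2.2⟩

theorem sqrt_two_bounds : √2 * √2 = 2 ∧ 1.41421 < √2 ∧ √2 < 1.41422 :=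
  ⟨Real.mul_self_sqrt (by norm_num), Real.lt_sqrt_of_sq_lt (by norm_num),
    (Real.sqrt_lt' (by norm_num)).2 (by norm_num)⟩

/-! ### Geometry of the resized half triangles -/

section HalfTriangle

variable {p u v : Plane}

/-- The half at the end of the leg `v`, resized to the leg `M`, of the triangle with leg `L`. -/
def InHalfTriangle (p u v : Plane) (L M : ℝ) : Circle → Prop :=
  InTriangle (p + L • v + (M * (√2 / 2)) • (u - v)) ((√2 / 2) • (v - u)) (-((√2 / 2) • (u + v))) M

theorem inHalfTriangle_frame (hu : inner ℝ u u = (1 : ℝ)) (hv : inner ℝ v v = (1 : ℝ))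
    (huv : inner ℝ u v = (0 : ℝ)) :
    inner ℝ ((√2 / 2) • (v - u)) ((√2 / 2) • (v - u)) = (1 : ℝ) ∧
    inner ℝ (-((√2 / 2) • (u + v))) (-((√2 / 2) • (u + v))) = (1 : ℝ) ∧
    inner ℝ ((√2 / 2) • (v - u)) (-((√2 / 2) • (u + v))) = (0 : ℝ) := by
  have hvu : inner ℝ v u = (0 : ℝ) := by rw [real_inner_comm]; exact huv
  have h2 := sqrt_two_bounds.1
  simp only [inner_add_left, inner_add_right, inner_sub_left, inner_sub_right, inner_neg_left,
    inner_neg_right, real_inner_smul_left, real_inner_smul_right, hu, hv, huv, hvu]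
  refine ⟨?_, ?_, ?_⟩
  · linear_combination (1 / 2) * h2
  · linear_combination (1 / 2) * h2
  · ring

/-- In the coordinates of the large triangle, the half has one leg on the old hypotenuse and its
hypotenuse on the old leg `v`. These two conditions do not involve `M`; resizing moves only the cut
perpendicular to the old hypotenuse. -/
theorem inHalfTriangle_iff (hu : inner ℝ u u = (1 : ℝ)) (hv : inner ℝ v v = (1 : ℝ))
    (huv : inner ℝ u v = (0 : ℝ)) (L M : ℝ) (D : Circle) :
    InHalfTriangle p u v L M D ↔
      √2 * D.radius ≤ inner ℝ v (D.center - p) - inner ℝ u (D.center - p) - L + √2 * M ∧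
      inner ℝ u (D.center - p) + inner ℝ v (D.center - p) + √2 * D.radius ≤ L ∧
      D.radius ≤ inner ℝ u (D.center - p) := by
  have hvu : inner ℝ v u = (0 : ℝ) := by rw [real_inner_comm]; exact huv
  have h2 := sqrt_two_bounds.1
  have h3 := sqrt_two_bounds.2.1
  have hc : D.center - (p + L • v + (M * (√2 / 2)) • (u - v)) =
    (D.center - p) - L • v - (M * (√2 / 2)) • (u - v) := by abel
  rw [InHalfTriangle, InTriangle, hc]
  generalize D.center - p = w
  simp only [inner_add_left, inner_sub_left, inner_sub_right, inner_neg_left,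
    real_inner_smul_left, real_inner_smul_right, hu, hv, huv, hvu]
  generalize inner ℝ u w = X
  generalize inner ℝ v w = Y
  generalize D.radius = r
  have e1 : √2 / 2 * (Y - X) - L * (√2 / 2 * (1 - 0)) - M * (√2 / 2) *
      (√2 / 2 * (0 - 1) - √2 / 2 * (1 - 0)) = √2 / 2 * (Y - X - L + √2 * M) := by ring
  have e2 : -(√2 / 2 * (X + Y)) - -(L * (√2 / 2 * (0 + 1))) - -(M * (√2 / 2) *
      (√2 / 2 * (1 + 0) - √2 / 2 * (0 + 1))) = √2 / 2 * (L - X - Y) := by ring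
  rw [e1, e2]
  have key : ∀ a : ℝ, r ≤ √2 / 2 * a ↔ √2 * r ≤ a := fun a => by
    have : √2 * (√2 / 2 * a) = a := by linear_combination (a / 2) * h2
    rw [← mul_le_mul_iff_right₀ (show 0 < √2 by linarith), this]
  have e3 : √2 / 2 * (Y - X - L + √2 * M) + √2 / 2 * (L - X - Y) + √2 * r ≤ M ↔ r ≤ X := by
    have : √2 / 2 * (Y - X - L + √2 * M) + √2 / 2 * (L - X - Y) + √2 * r = M + √2 * (r - X) := by
      linear_combination (M / 2) * h2
    rw [this, add_le_iff_nonpos_right, mul_nonpos_iff_pos_imp_nonpos]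
    constructor
    · intro h; linarith [h.1 (by linarith)]
    · intro h; exact ⟨fun _ => by linarith, fun _ => by linarith⟩
  rw [key, key, e3, le_sub_iff_add_le, le_sub_iff_add_le]
  constructor <;> rintro ⟨h1, h2, h3⟩ <;> refine ⟨h1, by linarith, h3⟩

/-- Only the leg along `u` can be crossed. A circle in the half stays `√2 * (M - D.radius) - L`
short of crossing it, so `hM` suffices. -/
theorem InHalfTriangle.inTriangle (hu : inner ℝ u u = (1 : ℝ)) (hv : inner ℝ v v = (1 : ℝ))
    (huv : inner ℝ u v = (0 : ℝ)) {L M : ℝ} {D : Circle} (h : InHalfTriangle p u v L M D)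
    (hM : √2 * (M - D.radius) ≤ L) : InTriangle p u v L D := by
  obtain ⟨h1, h2, h3⟩ := (inHalfTriangle_iff hu hv huv L M D).1 h
  exact ⟨h3, by linarith, h2⟩

/-- The halves occupy lengths `M` and `N` from opposite ends of the hypotenuse, which has length `√2
* L`; a line perpendicular to it separates them. -/
theorem InHalfTriangle.nonOverlapping (hu : inner ℝ u u = (1 : ℝ)) (hv : inner ℝ v v = (1 : ℝ))
    (huv : inner ℝ u v = (0 : ℝ)) {L M N : ℝ} {D E : Circle} (hD : InHalfTriangle p u v L M D)
    (hE : InHalfTriangle p v u L N E) (hMN : M + N ≤ √2 * L) : D.NonOverlapping E := by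
  have huv' : inner ℝ v u = (0 : ℝ) := by rw [real_inner_comm]; exact huv
  obtain ⟨h1, -, -⟩ := (inHalfTriangle_iff hu hv huv L M D).1 hD
  obtain ⟨h2, -, -⟩ := (inHalfTriangle_iff hv hu huv' L N E).1 hE
  obtain ⟨h3, h4, -⟩ := sqrt_two_bounds
  refine Circle.nonOverlapping_of_inner (inHalfTriangle_frame hu hv huv).1 ?_
  have hc : D.center - E.center = (D.center - p) - (E.center - p) := by abel
  rw [hc, real_inner_smul_left, inner_sub_left]
  generalize D.center - p = w at *
  generalize E.center - p = z at *
  rw [inner_sub_right, inner_sub_right]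
  have h5 : √2 * (M + N) ≤ 2 * L := by
    have := mul_le_mul_of_nonneg_left hMN (show 0 ≤ √2 by linarith)
    rwa [← mul_assoc, h3] at this
  have h6 := mul_le_mul_of_nonneg_left (show √2 * (D.radius + E.radius) ≤
    inner ℝ v w - inner ℝ v z - (inner ℝ u w - inner ℝ u z) by linarith)
    (show 0 ≤ √2 / 2 by linarith)
  linear_combination h6 - (D.radius + E.radius) / 2 * h3

end HalfTriangle

/-! ### Corner estimates -/

/-- A corner of a half that is too large for its triangle or square is cut off by less than the
radius `q` of the smallest circle in it. -/
theorem triangle_corner_bound {r r₁ r₂ q : ℝ} (hr : 0 ≤ r)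
    (hq : 0 ≤ q)
    (h : r₁ ^ 2 + r₂ ^ 2 ≤ r ^ 2) (hd : r₁ ^ 2 - r₂ ^ 2 ≤ q ^ 2) :
    √2 * ((2 + √2) * r₁ - q) ≤ (2 + √2) * r := by
  obtain ⟨h2, h3, h4⟩ := sqrt_two_bounds
  have hle : r₁ ≤ r := le_of_sq_le_sq (by nlinarith [sq_nonneg r₂]) hr
  by_contra! hlt
  have hm : q < (2 + √2) * r₁ - (1 + √2) * r := by
    refine lt_of_mul_lt_mul_left (a := √2) ?_ (by linarith)
    linear_combination hlt + r * h2
  -- The hypotheses give `2 * r₁ ^ 2 - r ^ 2 ≤ q ^ 2`. The difference factors with roots `r₁ = r`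
  -- (all in one group) and `r₁ = r / √2` (equal groups), and is nonpositive between them.
  have hfac : ((2 + √2) * r₁ - (1 + √2) * r) ^ 2 - (2 * r₁ ^ 2 - r ^ 2) =
      -((4 + 4 * √2) * ((r - r₁) * (r₁ - √2 / 2 * r))) := by
    linear_combination (r₁ ^ 2 - r ^ 2) * h2
  have hlow : √2 / 2 * r ≤ r₁ := by
    have : 0 < (2 + √2) * (r₁ - √2 / 2 * r) := by
      linear_combination hm + hq + r / 2 * h2
    linarith [pos_of_mul_pos_right this (by linarith)]
  have hsq : q ^ 2 < ((2 + √2) * r₁ - (1 + √2) * r) ^ 2 := pow_lt_pow_left₀ hm hq two_ne_zero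
  have : 0 ≤ (4 + 4 * √2) * ((r - r₁) * (r₁ - √2 / 2 * r)) :=
    mul_nonneg (by linarith) (mul_nonneg (by linarith) (by linarith))
  linarith

/-- A circle of radius `q` touching one leg reaches at most `(2 + √2) * r₁ - √2 * q` along it.
Failure would force `q < (1 + √2) * (r₁ - r)`, whereas balance gives `q ^ 2 ≥ 2 * (r₁ ^ 2 - r ^ 2)`;
these clash since `r₁ ≤ √2 * r`. -/
theorem square_corner_bound {r r₁ r₂ q : ℝ} (hr : 0 ≤ r)
    (hq : 0 ≤ q)
    (h : r₁ ^ 2 + r₂ ^ 2 ≤ 2 * r ^ 2) (hd : r₁ ^ 2 - r₂ ^ 2 ≤ q ^ 2) :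
    (2 + √2) * r₁ - √2 * q ≤ (2 + √2) * r := by
  obtain ⟨h2, h3, h4⟩ := sqrt_two_bounds
  have hle : r₁ ≤ √2 * r := by
    refine le_of_sq_le_sq ?_ (by positivity)
    rw [mul_pow, pow_two √2, h2]
    linarith [sq_nonneg r₂]
  by_contra! hlt
  have hm : q < (1 + √2) * (r₁ - r) := by
    refine lt_of_mul_lt_mul_left (a := √2) ?_ (by linarith)
    linear_combination hlt + (r - r₁) * h2
  have hpos : 0 < r₁ - r := pos_of_mul_pos_right (hq.trans_lt hm) (by linarith)
  have hsq : q ^ 2 < ((1 + √2) * (r₁ - r)) ^ 2 := pow_lt_pow_left₀ hm hq two_ne_zero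
  have h5 : (r₁ - r) * (2 * (r₁ + r)) < (r₁ - r) * ((3 + 2 * √2) * (r₁ - r)) := by
    linear_combination hsq + h + hd + (r₁ - r) ^ 2 * h2
  have h6 := lt_of_mul_lt_mul_left h5 hpos.le
  nlinarith

/-- The radius of the disk of area `c`. -/
noncomputable def radiusOf (c : ℝ) : ℝ := √(c / Real.pi)

theorem radiusOf_nonneg (c : ℝ) : 0 ≤ radiusOf c := Real.sqrt_nonneg _

theorem radiusOf_sq {c : ℝ} (hc : 0 ≤ c) : Real.pi * radiusOf c ^ 2 = c := by
  rw [radiusOf, Real.sq_sqrt (by positivity)]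
  field_simp

theorem radiusOf_pos {c : ℝ} (hc : 0 < c) : 0 < radiusOf c := Real.sqrt_pos.2 (by positivity)

theorem exists_lt_sum {C : Multiset ℝ} (hC : C ∈ circleSets) (hcard : 2 ≤ card C) :
    ∃ c ∈ C, c < C.sum := by
  obtain ⟨c, hc⟩ := card_pos_iff_exists_mem.1 (show 0 < card C by omega)
  obtain ⟨B, rfl⟩ := exists_cons_of_mem hc
  rw [card_cons] at hcard
  obtain ⟨d, hd⟩ := card_pos_iff_exists_mem.1 (show 0 < card B by omega)
  refine ⟨c, hc, ?_⟩
  rw [sum_cons, lt_add_iff_pos_right]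
  exact (hC d (mem_cons_of_mem hd)).trans_le
    (single_le_sum (fun b hb => (hC b (mem_cons_of_mem hb)).le) d hd)

/-- The conditions on the radii that a balanced split gives. -/
theorem radiusOf_split {C₁ C₂ : Multiset ℝ} (h₁ : C₁ ∈ circleSets)
    (h₂ : C₂ ∈ circleSets) (h : ∀ c ∈ C₁, C₁.sum - C₂.sum ≤ c) {D : Circle} (hD : D.area ∈ C₁) :
    radiusOf C₁.sum ^ 2 - radiusOf C₂.sum ^ 2 ≤ D.radius ^ 2 := by
  have hs₁ := radiusOf_sq (sum_nonneg fun c hc => (h₁ c hc).le)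
  have hs₂ := radiusOf_sq (sum_nonneg fun c hc => (h₂ c hc).le)
  have := h _ hD
  rw [D.area_eq, ← hs₁, ← hs₂, ← mul_sub] at this
  exact le_of_mul_le_mul_left this Real.pi_pos

theorem radiusOf_add_le {C₁ C₂ : Multiset ℝ} (h₁ : C₁ ∈ circleSets)
    (h₂ : C₂ ∈ circleSets) {t : ℝ} (h : C₁.sum + C₂.sum ≤ Real.pi * t) :
    radiusOf C₁.sum ^ 2 + radiusOf C₂.sum ^ 2 ≤ t := by
  have hs₁ := radiusOf_sq (sum_nonneg fun c hc => (h₁ c hc).le)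
  have hs₂ := radiusOf_sq (sum_nonneg fun c hc => (h₂ c hc).le)
  rw [← hs₁, ← hs₂, ← mul_add] at h
  exact le_of_mul_le_mul_left h Real.pi_pos

/-! ### Recursive packing of triangles -/

/-- A set of circles of the combined area of the incircle can be packed into an isosceles right
triangle. -/
theorem canPlace_inTriangle {C : Multiset ℝ} (hC : C ∈ circleSets) {p u v : Plane}
    (hu : inner ℝ u u = (1 : ℝ)) (hv : inner ℝ v v = (1 : ℝ)) (huv : inner ℝ u v = (0 : ℝ))
    {r : ℝ} (hr : 0 ≤ r) (hsum : C.sum ≤ Real.pi * r ^ 2) :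
    CanPlace C (InTriangle p u v ((2 + √2) * r)) := by
  obtain ⟨h2, h3, h4⟩ := sqrt_two_bounds
  have hvu : inner ℝ v u = (0 : ℝ) := by rw [real_inner_comm]; exact huv
  induction hn : card C using Nat.strong_induction_on generalizing C p u v r with
  | _ n ih =>
  rcases Nat.lt_or_ge (card C) 2 with hlt | hge
  · rcases Nat.lt_or_ge (card C) 1 with h0 | h1
    · obtain rfl : C = 0 := card_eq_zero.1 (by omega)
      exact ⟨[], by simp⟩
    · obtain ⟨c, rfl⟩ := card_eq_one.1 (by omega : card C = 1)
      have hc : 0 < c := hC c (by simp)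
      have hle : radiusOf c ≤ r := by
        rw [sum_singleton, ← radiusOf_sq hc.le] at hsum
        exact le_of_sq_le_sq (le_of_mul_le_mul_left hsum Real.pi_pos) hr
      refine ⟨[⟨p + radiusOf c • (u + v), radiusOf c, radiusOf_pos hc⟩], ?_, ?_, by simp⟩
      · simp [Circle.area_eq, radiusOf_sq hc.le]
      · simp only [List.mem_singleton, forall_eq, InTriangle, add_sub_cancel_left,
          real_inner_smul_right, inner_add_right, hu, hv, huv, hvu]
        refine ⟨by linarith, by linarith, ?_⟩
        have := mul_le_mul_of_nonneg_left hle (show 0 ≤ 2 + √2 by linarith)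
        linarith
  · obtain ⟨C₁, C₂, rfl, hd₁, hd₂⟩ := exists_balanced_split hC
    have hC₁ : C₁ ∈ circleSets := fun c hc => hC c (mem_add.2 (Or.inl hc))
    have hC₂ : C₂ ∈ circleSets := fun c hc => hC c (mem_add.2 (Or.inr hc))
    -- An empty part would make the difference the whole sum, which exceeds `c`; so both parts are
    -- nonempty and the induction on cardinality descends.
    obtain ⟨c, hc, hcs⟩ := exists_lt_sum hC hge
    have hpos₁ : 0 < card C₁ := by
      by_contra! h
      obtain rfl : C₁ = 0 := card_eq_zero.1 (by omega)
      simp only [zero_add, sum_zero, sub_zero] at hd₂ hc hcs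
      linarith [hd₂ c hc]
    have hpos₂ : 0 < card C₂ := by
      by_contra! h
      obtain rfl : C₂ = 0 := card_eq_zero.1 (by omega)
      simp only [add_zero, sum_zero, sub_zero] at hd₁ hc hcs
      linarith [hd₁ c hc]
    rw [card_add] at hn
    rw [sum_add] at hsum
    have hr₁₂ := radiusOf_add_le hC₁ hC₂ hsum
    have hr₂₁ := radiusOf_add_le hC₂ hC₁ (by rwa [add_comm])
    obtain ⟨f₁, f₂, f₃⟩ := inHalfTriangle_frame hu hv huv
    obtain ⟨g₁, g₂, g₃⟩ := inHalfTriangle_frame hv hu hvu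
    have place₁ : CanPlace C₁ (InHalfTriangle p u v ((2 + √2) * r)
        ((2 + √2) * radiusOf C₁.sum)) :=
      ih (card C₁) (by omega) hC₁ f₁ f₂ f₃ (radiusOf_nonneg _)
        (radiusOf_sq (sum_nonneg fun c hc => (hC₁ c hc).le)).ge
        (by rw [real_inner_comm]; exact f₃) rfl
    have place₂ : CanPlace C₂ (InHalfTriangle p v u ((2 + √2) * r)
        ((2 + √2) * radiusOf C₂.sum)) :=
      ih (card C₂) (by omega) hC₂ g₁ g₂ g₃ (radiusOf_nonneg _)
        (radiusOf_sq (sum_nonneg fun c hc => (hC₂ c hc).le)).ge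
        (by rw [real_inner_comm]; exact g₃) rfl
    refine place₁.add place₂ (fun D hD h => h.inTriangle hu hv huv ?_)
      (fun D hD h => (h.inTriangle hv hu hvu ?_).symm)
      (fun D E hD hE => hD.nonOverlapping hu hv huv hE ?_)
    · exact triangle_corner_bound hr D.radius_pos.le hr₁₂ (radiusOf_split hC₁ hC₂ hd₁ hD)
    · exact triangle_corner_bound hr D.radius_pos.le hr₂₁ (radiusOf_split hC₂ hC₁ hd₂ hD)
    · have : radiusOf C₁.sum + radiusOf C₂.sum ≤ √2 * r := by
        refine le_of_sq_le_sq ?_ (by positivity)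
        rw [mul_pow, pow_two √2, h2]
        linarith [sq_nonneg (radiusOf C₁.sum - radiusOf C₂.sum)]
      have := mul_le_mul_of_nonneg_left this (show 0 ≤ 2 + √2 by linarith)
      linarith

/-! ### Packing the standard square -/

/-- The axis-parallel square of side length `s` at the origin. -/
def stdSquare (s : ℝ) : Set Plane := {x : Plane | ∀ i, x i ∈ Set.Icc (0 : ℝ) s}

theorem Circle.disk_subset_stdSquare_iff {D : Circle} {s : ℝ} :
    D.disk ⊆ stdSquare s ↔ ∀ i, D.radius ≤ D.center i ∧ D.center i + D.radius ≤ s := by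
  constructor
  · intro h i
    have h₁ := h (show D.center + EuclideanSpace.single i D.radius ∈ D.disk by
      simp [Circle.disk, abs_of_pos D.radius_pos]) i
    have h₂ := h (show D.center - EuclideanSpace.single i D.radius ∈ D.disk by
      simp [Circle.disk, abs_of_pos D.radius_pos]) i
    simp at h₁ h₂
    exact ⟨h₂.1, h₁.2⟩
  · intro h x hx i
    have h₁ : |x i - D.center i| ≤ D.radius := by
      rw [Circle.disk, Metric.mem_closedBall, dist_eq_norm] at hx
      exact (PiLp.norm_apply_le (x - D.center) i).trans hx
    have := h i
    rw [abs_le] at h₁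
    exact ⟨by linarith, by linarith⟩

/-- A set of circles of the combined area of the twincircles can be packed into a square. -/
theorem canPack_stdSquare {C : Multiset ℝ} (hC : C ∈ circleSets) {r : ℝ} (hr : 0 ≤ r)
    (hsum : C.sum ≤ Real.pi * (2 * r ^ 2)) : CanPack C (stdSquare ((2 + √2) * r)) := by
  obtain ⟨h2, h3, h4⟩ := sqrt_two_bounds
  obtain ⟨C₁, C₂, rfl, hd₁, hd₂⟩ := exists_balanced_split hC
  have hC₁ : C₁ ∈ circleSets := fun c hc => hC c (mem_add.2 (Or.inl hc))
  have hC₂ : C₂ ∈ circleSets := fun c hc => hC c (mem_add.2 (Or.inr hc))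
  rw [sum_add] at hsum
  have hr₁₂ := radiusOf_add_le hC₁ hC₂ hsum
  have hr₂₁ := radiusOf_add_le hC₂ hC₁ (by rwa [add_comm])
  set u : Plane := EuclideanSpace.single 0 1 with hu_def
  set v : Plane := EuclideanSpace.single 1 1 with hv_def
  have hu : inner ℝ u u = (1 : ℝ) := by simp [hu_def]
  have hv : inner ℝ v v = (1 : ℝ) := by simp [hv_def]
  have huv : inner ℝ u v = (0 : ℝ) := by
    rw [hu_def, EuclideanSpace.inner_single_left]; simp [hv_def]
  have hux : ∀ x : Plane, inner ℝ u x = x 0 := fun x => by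
    rw [hu_def, EuclideanSpace.inner_single_left]; simp
  have hvx : ∀ x : Plane, inner ℝ v x = x 1 := fun x => by
    rw [hv_def, EuclideanSpace.inner_single_left]; simp
  have place₁ := canPlace_inTriangle hC₁ (p := 0) hu hv huv (radiusOf_nonneg _)
    (radiusOf_sq (sum_nonneg fun c hc => (hC₁ c hc).le)).ge
  have place₂ := canPlace_inTriangle hC₂ (p := ((2 + √2) * r) • (u + v)) (u := -u) (v := -v)
    (by simpa using hu) (by simpa using hv) (by simpa using huv) (radiusOf_nonneg _)
    (radiusOf_sq (sum_nonneg fun c hc => (hC₂ c hc).le)).ge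
  have hp₀ : (((2 + √2) * r) • (u + v)) 0 = (2 + √2) * r := by simp [hu_def, hv_def]
  have hp₁ : (((2 + √2) * r) • (u + v)) 1 = (2 + √2) * r := by simp [hu_def, hv_def]
  refine (place₁.add place₂ (Q := fun D => D.disk ⊆ stdSquare ((2 + √2) * r))
    (fun D hD h => ?_) (fun D hD h => ?_) (fun D E hD hE => ?_)).canPack fun D h => h
  · have hb := square_corner_bound hr D.radius_pos.le hr₁₂ (radiusOf_split hC₁ hC₂ hd₁ hD)
    simp only [InTriangle, hux, hvx, sub_zero] at h
    rw [Circle.disk_subset_stdSquare_iff, Fin.forall_fin_two]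
    refine ⟨⟨?_, ?_⟩, ?_, ?_⟩ <;> linarith
  · have hb := square_corner_bound hr D.radius_pos.le hr₂₁ (radiusOf_split hC₂ hC₁ hd₂ hD)
    simp only [InTriangle, inner_neg_left, hux, hvx, PiLp.sub_apply, hp₀, hp₁] at h
    rw [Circle.disk_subset_stdSquare_iff, Fin.forall_fin_two]
    refine ⟨⟨?_, ?_⟩, ?_, ?_⟩ <;> linarith
  -- The groups are separated along the diagonal direction, since `r₁ ^ 2 + r₂ ^ 2 ≤ 2 * r ^ 2`
  -- gives `r₁ + r₂ ≤ 2 * r`.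
  · refine Circle.nonOverlapping_of_inner (inHalfTriangle_frame hu hv huv).2.1 ?_
    simp only [InTriangle, inner_neg_left, hux, hvx, PiLp.sub_apply, hp₀, hp₁, sub_zero] at hD hE
    rw [inner_neg_left, real_inner_smul_left, inner_add_left, hux, hvx, PiLp.sub_apply,
      PiLp.sub_apply]
    have hle : radiusOf C₁.sum + radiusOf C₂.sum ≤ 2 * r := by
      refine le_of_sq_le_sq ?_ (by positivity)
      linarith [sq_nonneg (radiusOf C₁.sum - radiusOf C₂.sum)]
    have h5 := mul_le_mul_of_nonneg_left hle (show 0 ≤ 2 + √2 by linarith)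
    have h6 := mul_le_mul_of_nonneg_left (show √2 * (D.radius + E.radius) ≤
      -(D.center 0 - E.center 0 + (D.center 1 - E.center 1)) by linarith)
      (show 0 ≤ √2 / 2 by linarith)
    linear_combination h6 - (D.radius + E.radius) / 2 * h2

/-! ### Isometries, and the upper bound for twins -/

/-- The image of a circle under an isometry of the plane. -/
noncomputable def Circle.map (e : Plane ≃ᵢ Plane) (D : Circle) : Circle :=
  ⟨e D.center, D.radius, D.radius_pos⟩

theorem Circle.disk_map (e : Plane ≃ᵢ Plane) (D : Circle) : (D.map e).disk = e '' D.disk :=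
  (e.image_closedBall D.center D.radius).symm

theorem Circle.area_map (e : Plane ≃ᵢ Plane) (D : Circle) : (D.map e).area = D.area := by
  rw [Circle.area_eq, Circle.area_eq]; rfl

theorem Circle.NonOverlapping.map (e : Plane ≃ᵢ Plane) {D E : Circle} (h : D.NonOverlapping E) :
    (D.map e).NonOverlapping (E.map e) := by
  rw [Circle.nonOverlapping_iff] at h ⊢
  exact h.trans_eq (e.dist_eq _ _).symm

theorem IsPacking.map (e : Plane ≃ᵢ Plane) {P : Multiset Circle} {S : Set Plane}
    (h : IsPacking P S) : IsPacking (P.map (Circle.map e)) (e '' S) := by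
  obtain ⟨hS, l, rfl, hl⟩ := h
  refine ⟨fun D hD => ?_, l.map (Circle.map e), by simp, ?_⟩
  · obtain ⟨E, hE, rfl⟩ := mem_map.1 hD
    rw [Circle.disk_map]
    exact Set.image_mono (hS E hE)
  · exact List.pairwise_map.2 (hl.imp fun h => h.map e)

theorem CanPack.map (e : Plane ≃ᵢ Plane) {C : Multiset ℝ} {S : Set Plane} (h : CanPack C S) :
    CanPack C (e '' S) := by
  obtain ⟨P, rfl, hP⟩ := h
  exact ⟨P.map (Circle.map e), by simp [Circle.area_map], hP.map e⟩

theorem IsPacking.nonOverlapping {D E : Circle} {S : Set Plane} (h : IsPacking {D, E} S) :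
    D.NonOverlapping E := by
  have : Std.Symm Circle.NonOverlapping := ⟨fun _ _ h => Disjoint.symm h⟩
  have h' : Multiset.Pairwise Circle.NonOverlapping (([D, E] : List Circle) : Multiset Circle) :=
    h.2
  rw [pairwise_coe_iff_pairwise] at h'
  simpa using h'

/-- Two equal circles packed into a square are no larger than the circles of the same size in
opposite corners that touch each other. -/
theorem IsPacking.radius_le {D E : Circle} {s : ℝ} (h : IsPacking {D, E} (stdSquare s))
    (hDE : D.radius = E.radius) : (2 + √2) * D.radius ≤ s := by
  obtain ⟨h2, h3, h4⟩ := sqrt_two_bounds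
  have hD := Circle.disk_subset_stdSquare_iff.1 (h.1 D (by simp))
  have hE := Circle.disk_subset_stdSquare_iff.1 (h.1 E (by simp))
  have hdist := (Circle.nonOverlapping_iff D E).1 h.nonOverlapping
  rw [← hDE] at hdist hE
  have hr := D.radius_pos
  have hs : 0 ≤ s - 2 * D.radius := by linarith [hD 0]
  -- Both centers lie in the concentric square of side `s - 2 * D.radius`, whose diagonal bounds
  -- their distance.
  have hi : ∀ i, (D.center i - E.center i) ^ 2 ≤ (s - 2 * D.radius) ^ 2 := fun i =>
    sq_le_sq' (by linarith [hD i, hE i]) (by linarith [hD i, hE i])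
  have hsq : (D.radius + D.radius) ^ 2 ≤ 2 * (s - 2 * D.radius) ^ 2 := by
    refine (pow_le_pow_left₀ (by linarith) hdist 2).trans ?_
    rw [EuclideanSpace.dist_eq, Real.sq_sqrt (by positivity)]
    simp only [Fin.sum_univ_two, Real.dist_eq, sq_abs]
    linarith [hi 0, hi 1]
  have : √2 * D.radius ≤ s - 2 * D.radius := by
    refine le_of_sq_le_sq ?_ hs
    rw [mul_pow, pow_two √2, h2]
    linarith
  linarith

/-- Hausdorff measure is preserved by any isometry and agrees here with Lebesgue measure, so `e`
need not be shown affine. -/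
theorem area_image_stdSquare (e : Plane ≃ᵢ Plane) {s : ℝ} (hs : 0 ≤ s) :
    area (e '' stdSquare s) = s ^ 2 := by
  have hpre : stdSquare s = (WithLp.ofLp : Plane → Fin 2 → ℝ) ⁻¹'
      Set.Icc (fun _ => 0) (fun _ => s) := by
    ext x
    simp [stdSquare, Set.mem_Icc, Pi.le_def, forall_and]
  rw [area, Measure.real, ← EuclideanSpace.euclideanHausdorffMeasure_eq_volume,
    e.isometry.euclideanHausdorffMeasure_image,
    EuclideanSpace.euclideanHausdorffMeasure_eq_volume, hpre,
    (PiLp.volume_preserving_ofLp (Fin 2)).measure_preimage measurableSet_Icc.nullMeasurableSet,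
    Real.volume_Icc_pi_toReal fun _ => hs]
  simp

/-! ### Arbitrary squares: twincircles, tightness, density -/

section Square

variable {S : Set Plane} {r : ℝ}

theorem IsSquareOfSide.canPack (hS : IsSquareOfSide S ((2 + √2) * r)) (hr : 0 < r)
    {C : Multiset ℝ} (hC : C ∈ circleSets) (hsum : C.sum ≤ Real.pi * (2 * r ^ 2)) :
    CanPack C S := by
  obtain ⟨-, e, rfl⟩ := hS
  exact (canPack_stdSquare hC hr.le hsum).map e

theorem IsSquareOfSide.radius_le (hS : IsSquareOfSide S ((2 + √2) * r)) {D E : Circle}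
    (h : IsPacking {D, E} S) (hDE : D.radius = E.radius) : D.radius ≤ r := by
  obtain ⟨-, e, rfl⟩ := hS
  have h' := h.map e.symm
  rw [← stdSquare, show e.symm '' (e '' stdSquare ((2 + √2) * r)) = stdSquare ((2 + √2) * r) from
    e.toEquiv.symm_image_image _] at h'
  simp only [insert_eq_cons, map_cons, map_singleton] at h'
  exact le_of_mul_le_mul_left
    (IsPacking.radius_le (D := D.map e.symm) (E := E.map e.symm) h' hDE) (by positivity)

theorem IsSquareOfSide.not_canPack (hS : IsSquareOfSide S ((2 + √2) * r)) {b : ℝ}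
    (hb : Real.pi * (2 * r ^ 2) < b) : ¬ CanPack {b / 2, b / 2} S := by
  rintro ⟨P, hP, hPS⟩
  obtain ⟨D, E, rfl⟩ := card_eq_two.1 (by simpa using congr(card $hP))
  have hmem : ∀ F ∈ ({D, E} : Multiset Circle), F.area = b / 2 := fun F hF => by
    have := mem_map_of_mem Circle.area hF
    rw [hP] at this
    simpa using this
  have hD := hmem D (by simp)
  have hE := hmem E (by simp)
  have hDE : D.radius = E.radius := by
    rw [← hE, Circle.area_eq, Circle.area_eq] at hD
    exact (pow_left_inj₀ D.radius_pos.le E.radius_pos.le two_ne_zero).1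
      (mul_left_cancel₀ Real.pi_ne_zero hD)
  have hle := pow_le_pow_left₀ D.radius_pos.le (hS.radius_le hPS hDE) 2
  have := mul_le_mul_of_nonneg_left hle Real.pi_pos.le
  rw [Circle.area_eq] at hD
  linarith

/-- The twins need no explicit coordinates: they come from the packing result applied to two circles
of area `πr²`. -/
theorem IsSquareOfSide.exists_twins (hS : IsSquareOfSide S ((2 + √2) * r)) (hr : 0 < r) :
    ∃ D E : Circle, D.radius = r ∧ E.radius = r ∧ IsPacking {D, E} S := by
  have hpos : 0 < Real.pi * r ^ 2 := by positivity
  obtain ⟨P, hP, hPS⟩ := hS.canPack hr (C := {Real.pi * r ^ 2, Real.pi * r ^ 2})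
    (fun c hc => by
      obtain rfl : c = Real.pi * r ^ 2 := by simpa using hc
      exact hpos) (by simp only [insert_eq_cons, sum_cons, sum_singleton]; linarith)
  obtain ⟨D, E, rfl⟩ := card_eq_two.1 (by simpa using congr(card $hP))
  have hmem : ∀ F ∈ ({D, E} : Multiset Circle), F.radius = r := fun F hF => by
    have := mem_map_of_mem Circle.area hF
    rw [hP] at this
    have : F.area = Real.pi * r ^ 2 := by simpa using this
    rw [Circle.area_eq] at this
    exact (pow_left_inj₀ F.radius_pos.le hr.le two_ne_zero).1
      (mul_left_cancel₀ Real.pi_ne_zero this)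
  exact ⟨D, E, hmem D (by simp), hmem E (by simp), hPS⟩

theorem IsSquareOfSide.hasTwincircleArea_iff (hS : IsSquareOfSide S ((2 + √2) * r)) (hr : 0 < r)
    {a : ℝ} : HasTwincircleArea S a ↔ a = Real.pi * (2 * r ^ 2) := by
  obtain ⟨D, E, hD, hE, hDE⟩ := hS.exists_twins hr
  constructor
  · rintro ⟨D₁, D₂, ⟨heq, hP, hmax⟩, rfl⟩
    have h₁ : D₁.radius = r :=
      (hS.radius_le hP heq).antisymm (hD ▸ hmax D E (hD.trans hE.symm) hDE)
    rw [Circle.area_eq, Circle.area_eq, ← heq, h₁]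
    ring
  · rintro rfl
    refine ⟨D, E, ⟨hD.trans hE.symm, hDE, fun E₁ E₂ heq hP => hD ▸ hS.radius_le hP heq⟩, ?_⟩
    rw [Circle.area_eq, Circle.area_eq, hD, hE]
    ring

theorem IsSquareOfSide.exists_not_canPack (hS : IsSquareOfSide S ((2 + √2) * r)) (hr : 0 < r)
    {b : ℝ} (hb : Real.pi * (2 * r ^ 2) < b) :
    ∃ C ∈ circleSets, C.sum = b ∧ ¬ CanPack C S := by
  have hpos : 0 < b := lt_trans (by positivity) hb
  refine ⟨{b / 2, b / 2}, fun c hc => ?_, by simp, hS.not_canPack hb⟩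
  obtain rfl : c = b / 2 := by simpa using hc
  positivity

theorem IsSquareOfSide.hasCriticalDensity (hS : IsSquareOfSide S ((2 + √2) * r)) (hr : 0 < r) :
    HasCriticalDensity S (Real.pi / (3 + 2 * √2)) := by
  refine ⟨Real.pi * (2 * r ^ 2), ⟨fun C hC => hS.canPack hr hC.1 hC.2, fun A hA => ?_⟩, ?_⟩
  · by_contra! hlt
    obtain ⟨C, hC, hsum, hnot⟩ := hS.exists_not_canPack hr hlt
    exact hnot (hA C ⟨hC, hsum.le⟩)
  · obtain ⟨hs, e, rfl⟩ := hS
    rw [← stdSquare, area_image_stdSquare e hs.le,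
      div_eq_div_iff (by positivity) (by positivity)]
    -- The identity behind the density is `(2 + √2) ^ 2 = 2 * (3 + 2 * √2)`.
    linear_combination Real.pi * r ^ 2 * sqrt_two_bounds.1

end Square

end CirclePacking

theorem mainTheorem1 (S : Set CirclePacking.Plane) (s : ℝ)
    (hS : CirclePacking.IsSquareOfSide S s) :
    (∃ a : ℝ, CirclePacking.HasTwincircleArea S a) ∧
    (∀ a : ℝ, CirclePacking.HasTwincircleArea S a →
      (∀ C ∈ CirclePacking.circleSets, C.sum ≤ a → CirclePacking.CanPack C S) ∧
      (∀ b : ℝ, a < b →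
        ∃ C ∈ CirclePacking.circleSets, C.sum = b ∧ ¬ CirclePacking.CanPack C S)) ∧
    CirclePacking.HasCriticalDensity S (Real.pi / (3 + 2 * Real.sqrt 2)) ∧
    |Real.pi / (3 + 2 * Real.sqrt 2) - 0.5390| < 0.00005 := by
  obtain ⟨r, rfl⟩ : ∃ r, s = (2 + √2) * r := ⟨s / (2 + √2), by field_simp⟩
  have hr : 0 < r := pos_of_mul_pos_right hS.1 (by positivity)
  refine ⟨⟨_, (hS.hasTwincircleArea_iff hr).2 rfl⟩, fun a ha => ?_, hS.hasCriticalDensity hr, ?_⟩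
  · obtain rfl := (hS.hasTwincircleArea_iff hr).1 ha
    exact ⟨fun C hC hsum => hS.canPack hr hC hsum, fun b hb => hS.exists_not_canPack hr hb⟩
  · obtain ⟨-, h3, h4⟩ := CirclePacking.sqrt_two_bounds
    have h5 := Real.pi_gt_d6
    have h6 := Real.pi_lt_d6
    have hpos : (0 : ℝ) < 3 + 2 * √2 := by positivity
    rw [abs_lt, lt_sub_iff_add_lt, sub_lt_iff_lt_add, lt_div_iff₀ hpos, div_lt_iff₀ hpos]
    constructor <;> linarith
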